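/- **Setting.** For $T>0$ let $L_2(T)$ be the Hilbert space of complex-valued functions on $[0,T]$ that are square integrable with respect to the uniform probability measure on $[0,T]$. For a finite Borel measure $\mu$ on $\mathbb{R}$ let $\mathcal{K}_\mu : L_2(T)\to L_2(T)$ be the bounded positive operator $$[\mathcal{K}_\mu z](t)=\int_{\mathbb{R}} e^{2\pi i\xi t}\left[\frac1T\int_0^T z(s)\,e^{-2\pi i \xi s}\,ds\right]d\mu(\xi),$$ and for $\epsilon>0$ let the Fourier statistical dimension be $s_{\mu,\epsilon}=\operatorname{tr}\big(\mathcal{K}_\mu(\mathcal{K}_\mu+\epsilon\mathcal{I})^{-1}\big)\in[0,\infty]$, the trace of a positive operator being the sum of its diagonal entries in an orthonormal basis. **Theorem (Multiband Statistical Dimension).** Let $s\ge 1$, let $I_1,\dots,I_s\subset\mathbb{R}$ be pairwise disjoint bounded intervals (with or without their endpoints) of lengths $F_1,\dots,F_s>0$, let $\mu$ be the uniform probability measure on $I_1\cup\dots\cup I_s$, and let $T>0$. Then: 1. There is an absolute constant $C>0$ (independent of $s$, the intervals, $T$ and $\epsilon$) such that for all $0<\epsilon\le 1$ $$ s_{\mu,\epsilon}\le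 C\left(\sum_{i=1}^s F_iT+s\,\big(1+\log(1/\epsilon)\big)\right). $$ 2. Consequently $s_{\mu,\epsilon}=O\left(\sum_{i=1}^s F_iT+s\log(1/\epsilon)\right)$ for $\epsilon$ bounded away from $1$: for every $\epsilon_0\in(0,1)$ there is a constant $C>0$, depending only on $\epsilon_0$, such that for all $0<\epsilon\le\epsilon_0$ $$ s_{\mu,\epsilon}\le C\left(\sum_{i=1}^s F_iT+s\log(1/\epsilon)\right). $$ In particular $s_{\mu,\epsilon}$ is finite. -/

import Mathlib

open MeasureTheory ProbabilityTheory
open scoped ENNReal InnerProductSpace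

noncomputable section

/-- The uniform probability measure on the time window `[0, T]` (for `T > 0`), so that
`∫ s, f s ∂(timeMeasure T) = (1 / T) * ∫ s in [0, T], f s`. -/
abbrev timeMeasure (T : ℝ) : Measure ℝ := volume[|Set.Icc 0 T]

lemma integral_timeMeasure {T : ℝ} (hT : 0 < T) (f : ℝ → ℂ) :
    ∫ s, f s ∂(timeMeasure T) = (1 / T : ℝ) * ∫ s in Set.Icc 0 T, f s := by
  simp [timeMeasure, ProbabilityTheory.cond, integral_smul_measure, hT.le]

/-- `L₂(T)`: complex-valued functions on `[0, T]`, square integrable with respect to the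
uniform probability measure on `[0, T]`. -/
abbrev TimeL2 (T : ℝ) : Type := Lp ℂ 2 (timeMeasure T)

/-- `[F z](ξ) = (1 / T) ∫_{[0, T]} z(s) exp(-2πiξs) ds`. -/
def timeFourier (T : ℝ) (z : TimeL2 T) (ξ : ℝ) : ℂ :=
  ∫ s, z s * Complex.exp (-(2 * Real.pi * Complex.I * ξ * s)) ∂(timeMeasure T)

/-- `[K_μ z](t) = ∫ exp(2πiξt) [(1 / T) ∫_{[0, T]} z(s) exp(-2πiξs) ds] dμ(ξ)`,
as a function of `t`. -/
def kernelFun (T : ℝ) (μ : Measure ℝ) (z : TimeL2 T) (t : ℝ) : ℂ :=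
  ∫ ξ, Complex.exp (2 * Real.pi * Complex.I * ξ * t) * timeFourier T z ξ ∂μ

lemma norm_exp_freq (ξ t : ℝ) : ‖Complex.exp (2 * Real.pi * Complex.I * ξ * t)‖ = 1 := by
  rw [Complex.norm_exp]; simp

lemma norm_exp_neg_freq (ξ t : ℝ) :
    ‖Complex.exp (-(2 * Real.pi * Complex.I * ξ * t))‖ = 1 := by
  rw [Complex.norm_exp]; simp

lemma integrable_timeL2 (T : ℝ) (z : TimeL2 T) : Integrable z (timeMeasure T) :=
  (Lp.memLp z).integrable (by norm_num)

lemma integrable_timeFourier (T : ℝ) (z : TimeL2 T) (ξ : ℝ) :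
    Integrable (fun s : ℝ => z s * Complex.exp (-(2 * Real.pi * Complex.I * ξ * s)))
      (timeMeasure T) := by
  refine (integrable_timeL2 T z).mul_bdd (c := 1) ?_ ?_
  · exact (by fun_prop : Continuous fun s : ℝ =>
      Complex.exp (-(2 * Real.pi * Complex.I * ξ * s))).aestronglyMeasurable
  · exact Filter.Eventually.of_forall fun s => (norm_exp_neg_freq ξ s).le

lemma norm_timeFourier_le (T : ℝ) (z : TimeL2 T) (ξ : ℝ) : ‖timeFourier T z ξ‖ ≤ ‖z‖ := by
  have h1 : ‖timeFourier T z ξ‖ ≤ ∫ s, ‖z s‖ ∂(timeMeasure T) := by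
    refine (norm_integral_le_integral_norm _).trans (le_of_eq ?_)
    simp only [norm_mul, norm_exp_neg_freq, mul_one]
  refine h1.trans ?_
  rw [integral_norm_eq_lintegral_enorm (Lp.aestronglyMeasurable z), Lp.norm_def,
    ← eLpNorm_one_eq_lintegral_enorm]
  refine ENNReal.toReal_mono (Lp.eLpNorm_ne_top z) ?_
  rcases eq_zero_or_isProbabilityMeasure (timeMeasure T) with h | h
  · simp [h]
  · exact eLpNorm_le_eLpNorm_of_exponent_le (by norm_num) (Lp.aestronglyMeasurable z)

lemma continuous_timeFourier (T : ℝ) (z : TimeL2 T) : Continuous (timeFourier T z) := by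
  refine continuous_of_dominated (bound := fun s => ‖z s‖)
    (fun ξ => (integrable_timeFourier T z ξ).aestronglyMeasurable) ?_
    (integrable_timeL2 T z).norm ?_
  · exact fun ξ => Filter.Eventually.of_forall fun s => by simp [norm_exp_neg_freq]
  · exact Filter.Eventually.of_forall fun s => by fun_prop

lemma timeFourier_add (T : ℝ) (z w : TimeL2 T) (ξ : ℝ) :
    timeFourier T (z + w) ξ = timeFourier T z ξ + timeFourier T w ξ := by
  unfold timeFourier
  rw [← integral_add (integrable_timeFourier T z ξ) (integrable_timeFourier T w ξ)]
  refine integral_congr_ae ?_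
  filter_upwards [Lp.coeFn_add z w] with s hs
  rw [hs, Pi.add_apply, add_mul]

lemma timeFourier_smul (T : ℝ) (c : ℂ) (z : TimeL2 T) (ξ : ℝ) :
    timeFourier T (c • z) ξ = c * timeFourier T z ξ := by
  unfold timeFourier
  rw [← integral_const_mul]
  refine integral_congr_ae ?_
  filter_upwards [Lp.coeFn_smul c z] with s hs
  rw [hs, Pi.smul_apply, smul_eq_mul, mul_assoc]

lemma integrable_kernelFun (T : ℝ) (μ : Measure ℝ) [IsFiniteMeasure μ] (z : TimeL2 T) (t : ℝ) :
    Integrable (fun ξ : ℝ =>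
      Complex.exp (2 * Real.pi * Complex.I * ξ * t) * timeFourier T z ξ) μ := by
  have hc := continuous_timeFourier T z
  refine Integrable.of_bound (C := ‖z‖) ?_ ?_
  · exact (by fun_prop : Continuous fun ξ : ℝ =>
      Complex.exp (2 * Real.pi * Complex.I * ξ * t) * timeFourier T z ξ).aestronglyMeasurable
  · exact Filter.Eventually.of_forall fun ξ => by
      rw [norm_mul, norm_exp_freq, one_mul]; exact norm_timeFourier_le T z ξ

lemma norm_kernelFun_le (T : ℝ) (μ : Measure ℝ) [IsFiniteMeasure μ] (z : TimeL2 T) (t : ℝ) :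
    ‖kernelFun T μ z t‖ ≤ ‖z‖ * μ.real Set.univ := by
  refine norm_integral_le_of_norm_le_const (Filter.Eventually.of_forall fun ξ => ?_)
  rw [norm_mul, norm_exp_freq, one_mul]
  exact norm_timeFourier_le T z ξ

lemma continuous_kernelFun (T : ℝ) (μ : Measure ℝ) [IsFiniteMeasure μ] (z : TimeL2 T) :
    Continuous (kernelFun T μ z) := by
  refine continuous_of_dominated (bound := fun _ => ‖z‖)
    (fun t => (integrable_kernelFun T μ z t).aestronglyMeasurable) ?_
    (integrable_const _) ?_
  · exact fun t => Filter.Eventually.of_forall fun ξ => by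
      rw [norm_mul, norm_exp_freq, one_mul]; exact norm_timeFourier_le T z ξ
  · exact Filter.Eventually.of_forall fun ξ => by fun_prop

lemma memLp_kernelFun (T : ℝ) (μ : Measure ℝ) [IsFiniteMeasure μ] (z : TimeL2 T) :
    MemLp (kernelFun T μ z) 2 (timeMeasure T) :=
  MemLp.of_bound (continuous_kernelFun T μ z).aestronglyMeasurable _
    (Filter.Eventually.of_forall (norm_kernelFun_le T μ z))

lemma kernelFun_add (T : ℝ) (μ : Measure ℝ) [IsFiniteMeasure μ] (z w : TimeL2 T) :
    kernelFun T μ (z + w) = kernelFun T μ z + kernelFun T μ w := by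
  funext t
  rw [Pi.add_apply]
  unfold kernelFun
  rw [← integral_add (integrable_kernelFun T μ z t) (integrable_kernelFun T μ w t)]
  simp only [timeFourier_add, mul_add]

lemma kernelFun_smul (T : ℝ) (μ : Measure ℝ) (c : ℂ) (z : TimeL2 T) :
    kernelFun T μ (c • z) = c • kernelFun T μ z := by
  funext t
  rw [Pi.smul_apply, smul_eq_mul]
  unfold kernelFun
  rw [← integral_const_mul]
  refine integral_congr_ae (Filter.Eventually.of_forall fun ξ => ?_)
  simp only [timeFourier_smul]
  ring

/-- The kernel operator `K_μ : L₂(T) → L₂(T)`, sending `z` to the class of `kernelFun T μ z`. -/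
def kernelOp (T : ℝ) (μ : Measure ℝ) [IsFiniteMeasure μ] : TimeL2 T →L[ℂ] TimeL2 T :=
  LinearMap.mkContinuous
    { toFun := fun z => (memLp_kernelFun T μ z).toLp (kernelFun T μ z)
      map_add' := fun z w => by
        rw [← MemLp.toLp_add]
        exact MemLp.toLp_congr _ _ (by rw [kernelFun_add])
      map_smul' := fun c z => by
        rw [RingHom.id_apply, ← MemLp.toLp_const_smul]
        exact MemLp.toLp_congr _ _ (by rw [kernelFun_smul]) }
    (measureUnivNNReal (timeMeasure T) ^ (2 : ℝ≥0∞).toReal⁻¹ * μ.real Set.univ)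
    (fun z => by
      refine (Lp.norm_le_of_ae_bound (C := ‖z‖ * μ.real Set.univ) (by positivity) ?_).trans
        (le_of_eq (by ring))
      filter_upwards [MemLp.coeFn_toLp (memLp_kernelFun T μ z)] with t ht
      simp only [LinearMap.coe_mk, AddHom.coe_mk]
      rw [ht]
      exact norm_kernelFun_le T μ z t)

/-- `⟪z, K_μ z⟫ = ∫ |F z|² dμ`; so `K_μ` is positive. -/
lemma inner_kernelOp (T : ℝ) (μ : Measure ℝ) [IsFiniteMeasure μ] (z : TimeL2 T) :
    ⟪z, kernelOp T μ z⟫_ℂ = ((∫ ξ, ‖timeFourier T z ξ‖ ^ 2 ∂μ : ℝ) : ℂ) := by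
  have hc := continuous_timeFourier T z
  have h0 : ⟪z, kernelOp T μ z⟫_ℂ =
      ∫ t, ∫ ξ, (starRingEnd ℂ (z t)) *
        (Complex.exp (2 * Real.pi * Complex.I * ξ * t) * timeFourier T z ξ)
          ∂μ ∂(timeMeasure T) := by
    rw [L2.inner_def]
    refine integral_congr_ae ?_
    filter_upwards [MemLp.coeFn_toLp (memLp_kernelFun T μ z)] with t ht
    have : kernelOp T μ z t = kernelFun T μ z t := ht
    rw [this, integral_const_mul, RCLike.inner_apply, mul_comm]
    rfl
  rw [h0, integral_integral_swap, ← integral_complex_ofReal]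
  · refine integral_congr_ae (Filter.Eventually.of_forall fun ξ => ?_)
    simp only
    have h1 : ∫ t, (starRingEnd ℂ (z t)) *
        (Complex.exp (2 * Real.pi * Complex.I * ξ * t) * timeFourier T z ξ) ∂(timeMeasure T)
        = starRingEnd ℂ (timeFourier T z ξ) * timeFourier T z ξ := by
      have h2 : starRingEnd ℂ (timeFourier T z ξ) = ∫ t, starRingEnd ℂ (z t) *
          Complex.exp (2 * Real.pi * Complex.I * ξ * t) ∂(timeMeasure T) := by
        rw [timeFourier, ← integral_conj]
        refine integral_congr_ae (Filter.Eventually.of_forall fun t => ?_)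
        simp only [map_mul, ← Complex.exp_conj, map_neg, Complex.conj_I, Complex.conj_ofReal,
          map_ofNat]
        ring_nf
      rw [h2, ← integral_mul_const]
      simp only [mul_assoc]
    rw [h1, mul_comm, Complex.mul_conj, Complex.normSq_eq_norm_sq]
  · have hb : Integrable (fun p : ℝ × ℝ => (starRingEnd ℂ (z p.1)))
        ((timeMeasure T).prod μ) :=
      ((Complex.conjCLE : ℂ →L[ℝ] ℂ).integrable_comp (integrable_timeL2 T z)).comp_fst μ
    refine hb.mul_bdd (c := ‖z‖) ?_ (Filter.Eventually.of_forall fun p => ?_)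
    · exact (by fun_prop : Continuous fun p : ℝ × ℝ =>
        Complex.exp (2 * Real.pi * Complex.I * p.2 * p.1) *
          timeFourier T z p.2).aestronglyMeasurable
    · rw [norm_mul, norm_exp_freq, one_mul]; exact norm_timeFourier_le T z p.2

/-- For `ε > 0` the operator `K_μ + ε I` is invertible, so its `Ring.inverse` is a genuine inverse. -/
lemma isUnit_kernelOp_add (T : ℝ) (μ : Measure ℝ) [IsFiniteMeasure μ] {ε : ℝ} (hε : 0 < ε) :
    IsUnit (kernelOp T μ + (ε : ℂ) • 1) := by
  refine ContinuousLinearMap.isUnit_of_forall_le_norm_inner_map _ (c := ⟨ε, hε.le⟩) hε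
    fun z => ?_
  rw [← inner_conj_symm, RCLike.norm_conj]
  have h : ⟪z, (kernelOp T μ + (ε : ℂ) • 1) z⟫_ℂ =
      ((∫ ξ, ‖timeFourier T z ξ‖ ^ 2 ∂μ + ε * ‖z‖ ^ 2 : ℝ) : ℂ) := by
    rw [add_apply, inner_add_right, inner_kernelOp, smul_apply,
      one_apply_eq_self, inner_smul_right, inner_self_eq_norm_sq_to_K]
    simp
  have h2 : 0 ≤ ∫ ξ, ‖timeFourier T z ξ‖ ^ 2 ∂μ := by positivity
  rw [h, Complex.norm_real, Real.norm_of_nonneg (by positivity)]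
  change ‖z‖ ^ 2 * ε ≤ _
  nlinarith

lemma isPositive_kernelOp (T : ℝ) (μ : Measure ℝ) [IsFiniteMeasure μ] :
    (kernelOp T μ).IsPositive := by
  rw [ContinuousLinearMap.isPositive_iff_complex]
  intro z
  have := inner_kernelOp T μ z
  rw [← inner_conj_symm, this, Complex.conj_ofReal]
  exact ⟨by simp, by simpa using (by positivity : 0 ≤ ∫ ξ, ‖timeFourier T z ξ‖ ^ 2 ∂μ)⟩

/-- `K_μ (K_μ + ε I)⁻¹` is a positive operator. -/
lemma isPositive_kernelOp_mul_inverse (T : ℝ) (μ : Measure ℝ) [IsFiniteMeasure μ] {ε : ℝ}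
    (hε : 0 < ε) :
    (kernelOp T μ * Ring.inverse (kernelOp T μ + (ε : ℂ) • 1)).IsPositive := by
  rw [ContinuousLinearMap.isPositive_iff_complex]
  intro x
  obtain ⟨y, rfl⟩ : ∃ y, x = (kernelOp T μ + (ε : ℂ) • 1) y :=
    ⟨Ring.inverse (kernelOp T μ + (ε : ℂ) • 1) x, by
      rw [← mul_apply_eq_comp, Ring.mul_inverse_cancel _ (isUnit_kernelOp_add T μ hε),
        one_apply_eq_self]⟩
  have h1 : (kernelOp T μ * Ring.inverse (kernelOp T μ + (ε : ℂ) • 1))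
      ((kernelOp T μ + (ε : ℂ) • 1) y) = kernelOp T μ y := by
    rw [mul_apply_eq_comp, ← mul_apply_eq_comp (Ring.inverse _),
      Ring.inverse_mul_cancel _ (isUnit_kernelOp_add T μ hε), one_apply_eq_self]
  have h2 : ⟪kernelOp T μ y, (kernelOp T μ + (ε : ℂ) • 1) y⟫_ℂ =
      ((‖kernelOp T μ y‖ ^ 2 + ε * ∫ ξ, ‖timeFourier T y ξ‖ ^ 2 ∂μ : ℝ) : ℂ) := by
    rw [add_apply, inner_add_right, smul_apply, one_apply_eq_self, inner_smul_right,
      inner_self_eq_norm_sq_to_K, ← inner_conj_symm, inner_kernelOp, Complex.conj_ofReal]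
    push_cast
    rfl
  have h3 : 0 ≤ ∫ ξ, ‖timeFourier T y ξ‖ ^ 2 ∂μ := by positivity
  rw [h1, h2]
  exact ⟨by rw [RCLike.re_eq_complex_re, Complex.ofReal_re],
    by rw [RCLike.re_eq_complex_re, Complex.ofReal_re]; positivity⟩

/-- The trace `∑ ⟪e, A e⟫` of a positive bounded operator on a complex Hilbert space, summed over
an orthonormal (Hilbert) basis and valued in `[0, ∞]`; it is finite iff `A` is trace class. -/
def opTrace {E : Type*} [NormedAddCommGroup E] [InnerProductSpace ℂ E] [CompleteSpace E]
    (A : E →L[ℂ] E) : ℝ≥0∞ :=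
  ∑' e : (exists_hilbertBasis ℂ E).choose, ENNReal.ofReal (⟪(e : E), A e⟫_ℂ).re

lemma ofReal_norm_sq_eq_tsum {E ι : Type*} [NormedAddCommGroup E] [InnerProductSpace ℂ E]
    (c : HilbertBasis ι ℂ E) (x : E) :
    ENNReal.ofReal (‖x‖ ^ 2) = ∑' i, ENNReal.ofReal (‖⟪c i, x⟫_ℂ‖ ^ 2) := by
  have h := c.hasSum_inner_mul_inner x x
  have e1 : ∀ i, ⟪x, c i⟫_ℂ * ⟪c i, x⟫_ℂ = ((‖⟪c i, x⟫_ℂ‖ ^ 2 : ℝ) : ℂ) := fun i => by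
    rw [← inner_conj_symm x (c i), mul_comm, Complex.mul_conj, Complex.normSq_eq_norm_sq]
  have e2 : ⟪x, x⟫_ℂ = ((‖x‖ ^ 2 : ℝ) : ℂ) := by
    rw [inner_self_eq_norm_sq_to_K]; norm_cast
  rw [e2, funext e1] at h
  have h' : HasSum (fun i => ‖⟪c i, x⟫_ℂ‖ ^ 2) (‖x‖ ^ 2) := by exact_mod_cast h
  rw [← h'.tsum_eq, ENNReal.ofReal_tsum_of_nonneg (fun _ => by positivity) h'.summable]

/-- For a positive operator the basis sum in `opTrace` does not depend on the basis. -/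
lemma opTrace_eq {E ι : Type*} [NormedAddCommGroup E] [InnerProductSpace ℂ E] [CompleteSpace E]
    (A : E →L[ℂ] E) (hA : A.IsPositive) (b : HilbertBasis ι ℂ E) :
    opTrace A = ∑' i, ENNReal.ofReal (⟪b i, A (b i)⟫_ℂ).re := by
  have hA0 : 0 ≤ A := by rwa [ContinuousLinearMap.nonneg_iff_isPositive]
  have hS : CFC.sqrt A * CFC.sqrt A = A := CFC.sqrt_mul_sqrt_self A hA0
  have hSp : IsSelfAdjoint (CFC.sqrt A) := (CFC.sqrt_nonneg A).isSelfAdjoint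
  have hsym : ∀ x y, ⟪CFC.sqrt A x, y⟫_ℂ = ⟪x, CFC.sqrt A y⟫_ℂ := fun x y => hSp.isSymmetric x y
  have quad : ∀ x, (⟪x, A x⟫_ℂ).re = ‖CFC.sqrt A x‖ ^ 2 := by
    intro x
    have h : A x = CFC.sqrt A (CFC.sqrt A x) := by
      rw [← mul_apply_eq_comp, hS]
    rw [h, ← hsym, inner_self_eq_norm_sq_to_K]
    norm_cast
  obtain ⟨d, hd⟩ := (exists_hilbertBasis ℂ E).choose_spec
  have hd' : opTrace A = ∑' j, ENNReal.ofReal (⟪d j, A (d j)⟫_ℂ).re := by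
    simp only [hd]; rfl
  rw [hd']
  simp only [quad]
  rw [tsum_congr fun j => ofReal_norm_sq_eq_tsum b (CFC.sqrt A (d j)), ENNReal.tsum_comm]
  refine tsum_congr fun i => ?_
  rw [ofReal_norm_sq_eq_tsum d (CFC.sqrt A (b i))]
  refine tsum_congr fun j => ?_
  rw [← hsym, norm_inner_symm]

/-- The Fourier statistical dimension `s_{μ,ε} = tr (K_μ (K_μ + ε I)⁻¹)`. -/
def statDim (T : ℝ) (μ : Measure ℝ) [IsFiniteMeasure μ] (ε : ℝ) : ℝ≥0∞ :=
  opTrace (kernelOp T μ * Ring.inverse (kernelOp T μ + (ε : ℂ) • 1))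

end

/-! Write `A = K (K + ε)⁻¹` with `K` the kernel operator. As quadratic forms `A ≤ 1` and `ε A ≤ K`.
Hence for any finite-dimensional `V`, the trace of `A` is at most `dim V`, from the first bound,
plus `1/ε` times the trace of `K` on `Vᗮ`, from the second (`opTrace_le_finrank_add`,
`statDim_le_finrank_add`).

The operator `K` is an average over `μ` of rank-one projections onto exponentials. If `μ`-almost
every exponential lies within `δ` of `V`, Bessel's inequality bounds the trace of `K` on `Vᗮ` by `δ
^ 2` (`sum_re_inner_kernelOp_le`).

To build `V`, fix a point `c` in each band. On `[0, T]` the Taylor polynomial of `exp (2πi(ξ - c)s)`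
with `n` terms has error at most `2 exp (-n)` once `n ≥ 18π|ξ - c|T`. So about `18π F T + log (1/ε)`
monomials modulated at `c` serve the whole band with `δ = 2ε`. Summing the dimensions over the bands
gives the estimate, and the remaining term is `δ ^ 2 / ε = 4ε`. -/

section Resolvent

/-! ### Resolvent inequalities and the trace of a positive contraction. -/

variable {E : Type*} [NormedAddCommGroup E] [InnerProductSpace ℂ E]

/-- For positive `K` one has `K (K + ε)⁻¹ ≤ 1` as quadratic forms. -/
lemma re_inner_mul_inverse_le_norm_sq {K : E →L[ℂ] E} (hK : K.IsPositive) {ε : ℝ} (hε : 0 < ε)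
    (hu : IsUnit (K + (ε : ℂ) • 1)) (x : E) :
    (⟪x, (K * Ring.inverse (K + (ε : ℂ) • 1)) x⟫_ℂ).re ≤ ‖x‖ ^ 2 := by
  set y := Ring.inverse (K + (ε : ℂ) • 1) x with hy
  have hx : x = K y + (ε : ℂ) • y := by
    have h : (K + (ε : ℂ) • 1) y = x := by
      rw [hy, ← mul_apply_eq_comp, Ring.mul_inverse_cancel _ hu, one_apply_eq_self]
    simpa using h.symm
  have hA : (K * Ring.inverse (K + (ε : ℂ) • 1)) x = K y := rfl
  have h1 : (⟪x, x⟫_ℂ).re = ‖x‖ ^ 2 := by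
    rw [inner_self_eq_norm_sq_to_K]; norm_cast
  have h2 : ⟪x, x⟫_ℂ = ⟪x, K y⟫_ℂ + ε * ⟪x, y⟫_ℂ := by
    conv_lhs => rw [hx, inner_add_right, inner_smul_right, ← hx]
  -- The deficit `‖x‖² - Re⟪x, K y⟫` is `ε Re⟪x, y⟫`, and `⟪x, y⟫ = ⟪K y, y⟫ + ε‖y‖²`.
  have h3 : 0 ≤ (⟪x, y⟫_ℂ).re := by
    rw [hx, inner_add_left, inner_smul_left, Complex.conj_ofReal, Complex.add_re,
      Complex.re_ofReal_mul, inner_self_eq_norm_sq_to_K]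
    have := hK.re_inner_nonneg_left y
    have h4 : (((‖y‖ : ℝ) : ℂ) ^ 2).re = ‖y‖ ^ 2 := by norm_cast
    rw [RCLike.re_eq_complex_re] at this
    have h5 : 0 ≤ ε * ‖y‖ ^ 2 := by positivity
    exact add_nonneg this (h4 ▸ h5)
  rw [hA, ← h1, h2, Complex.add_re, Complex.re_ofReal_mul]
  nlinarith

variable [CompleteSpace E]

/-- For positive `K` one has `ε K (K + ε)⁻¹ ≤ K` as quadratic forms. -/
lemma mul_re_inner_mul_inverse_le {K : E →L[ℂ] E} (hK : K.IsPositive) {ε : ℝ} (hε : 0 < ε)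
    (hu : IsUnit (K + (ε : ℂ) • 1)) (x : E) :
    ε * (⟪x, (K * Ring.inverse (K + (ε : ℂ) • 1)) x⟫_ℂ).re ≤ (⟪x, K x⟫_ℂ).re := by
  set y := Ring.inverse (K + (ε : ℂ) • 1) x with hy
  have hx : x = K y + (ε : ℂ) • y := by
    have h : (K + (ε : ℂ) • 1) y = x := by
      rw [hy, ← mul_apply_eq_comp, Ring.mul_inverse_cancel _ hu, one_apply_eq_self]
    simpa using h.symm
  have hA : (K * Ring.inverse (K + (ε : ℂ) • 1)) x = K y := rfl
  have h2 : ⟪x, K x⟫_ℂ = ⟪x, K (K y)⟫_ℂ + ε * ⟪x, K y⟫_ℂ := by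
    conv_lhs => rw [hx, map_add, map_smul, inner_add_right, inner_smul_right, ← hx]
  -- Expanding `x` on the left gives `⟪K y, K (K y)⟫ + ε‖K y‖²`, both terms nonnegative.
  have h3 : 0 ≤ (⟪x, K (K y)⟫_ℂ).re := by
    have h6 : ⟪y, K (K y)⟫_ℂ = ⟪K y, K y⟫_ℂ := (hK.isSelfAdjoint.isSymmetric y (K y)).symm
    rw [hx, inner_add_left, inner_smul_left, Complex.conj_ofReal, Complex.add_re,
      Complex.re_ofReal_mul, h6, inner_self_eq_norm_sq_to_K]
    have := hK.re_inner_nonneg_right (K y)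
    have h4 : (((‖K y‖ : ℝ) : ℂ) ^ 2).re = ‖K y‖ ^ 2 := by norm_cast
    rw [RCLike.re_eq_complex_re] at this
    have h5 : 0 ≤ ε * ‖K y‖ ^ 2 := by positivity
    exact add_nonneg this (h4 ▸ h5)
  rw [hA, h2, Complex.add_re, Complex.re_ofReal_mul]
  linarith

/-- A Hilbert basis each of whose elements lies in a given finite-dimensional subspace or in its
orthogonal complement. -/
lemma exists_hilbertBasis_mem_or_mem_orthogonal (V : Submodule ℂ E) [FiniteDimensional ℂ V] :
    ∃ (w : Set E) (b : HilbertBasis w ℂ E), ⇑b = Subtype.val ∧ ∀ e ∈ w, e ∈ V ∨ e ∈ Vᗮ := by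
  have ho : Orthonormal ℂ fun i => (stdOrthonormalBasis ℂ V i : E) :=
    (stdOrthonormalBasis ℂ V).orthonormal.comp_linearIsometry V.subtypeₗᵢ
  obtain ⟨w, b, hsw, hb⟩ := ho.toSubtypeRange.exists_hilbertBasis_extension
  have hbo : Orthonormal ℂ (Subtype.val : w → E) := hb ▸ b.orthonormal
  refine ⟨w, b, hb, fun e he => ?_⟩
  by_cases hs : e ∈ Set.range fun i => (stdOrthonormalBasis ℂ V i : E)
  · obtain ⟨i, rfl⟩ := hs
    exact Or.inl (Subtype.mem _)
  · refine Or.inr ((Submodule.mem_orthogonal V e).2 fun u hu => ?_)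
    -- A vector added in the extension is orthogonal to the basis of `V`, hence to `V`.
    have hz : ∀ i, ⟪(stdOrthonormalBasis ℂ V i : E), e⟫_ℂ = 0 := fun i => by
      refine hbo.2 (i := ⟨_, hsw ⟨i, rfl⟩⟩) (j := ⟨e, he⟩) fun h => hs ⟨i, ?_⟩
      exact congrArg Subtype.val h
    have := congrArg (V.subtype) ((stdOrthonormalBasis ℂ V).sum_repr ⟨u, hu⟩)
    simp only [map_sum, map_smul, Submodule.subtype_apply] at this
    rw [← this, sum_inner]
    exact Finset.sum_eq_zero fun i _ => by rw [inner_smul_left, hz, mul_zero]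

/-- A positive contraction has trace at most `dim V` plus its trace on `Vᗮ`. -/
lemma opTrace_le_finrank_add {A : E →L[ℂ] E} (hA : A.IsPositive)
    (hA1 : ∀ x, (⟪x, A x⟫_ℂ).re ≤ ‖x‖ ^ 2) (V : Submodule ℂ E) [FiniteDimensional ℂ V] {δ : ℝ}
    (hδ : ∀ S : Finset E, Orthonormal ℂ (Subtype.val : S → E) → (∀ e ∈ S, e ∈ Vᗮ) →
      ∑ e ∈ S, (⟪e, A e⟫_ℂ).re ≤ δ) :
    opTrace A ≤ ENNReal.ofReal (Module.finrank ℂ V + δ) := by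
  classical
  obtain ⟨w, b, hb, hw⟩ := exists_hilbertBasis_mem_or_mem_orthogonal V
  have hbo : Orthonormal ℂ (Subtype.val : w → E) := hb ▸ b.orthonormal
  rw [opTrace_eq A hA b, ENNReal.tsum_eq_iSup_sum]
  refine iSup_le fun S => ?_
  have hnn : ∀ e, 0 ≤ (⟪b e, A (b e)⟫_ℂ).re := fun e => hA.re_inner_nonneg_right (b e)
  rw [← ENNReal.ofReal_sum_of_nonneg fun e _ => hnn e]
  refine ENNReal.ofReal_le_ofReal ?_
  -- Basis vectors in `V` number at most `dim V` and contribute at most 1 each; the others lie in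
  -- `Vᗮ`, where `hδ` applies.
  rw [hb, ← Finset.sum_filter_add_sum_filter_not S (fun e => (e : E) ∈ V)]
  refine add_le_add ?_ ?_
  · have hcard : (S.filter fun e : w => (e : E) ∈ V).card ≤ Module.finrank ℂ V := by
      have hli : LinearIndependent ℂ
          fun e : (S.filter fun e : w => (e : E) ∈ V) => (⟨e, (Finset.mem_filter.1 e.2).2⟩ : V) := by
        refine LinearIndependent.of_comp V.subtype ?_
        exact hbo.linearIndependent.comp (fun e : (S.filter fun e : w => (e : E) ∈ V) => (e : w))
          Subtype.val_injective
      simpa using hli.fintype_card_le_finrank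
    refine (Finset.sum_le_card_nsmul _ _ 1 fun e _ => ?_).trans ?_
    · simpa [hbo.1 e] using hA1 e
    · simpa using hcard
  · refine (Finset.sum_map (S.filter fun e : w => ¬ (e : E) ∈ V)
      (Function.Embedding.subtype (· ∈ w)) fun e => (⟪e, A e⟫_ℂ).re).symm.trans_le ?_
    have hsub : ∀ e ∈ (S.filter fun e : w => ¬ (e : E) ∈ V).map (Function.Embedding.subtype (· ∈ w)),
        e ∈ w ∧ e ∉ V := by
      intro e he
      obtain ⟨f, hf, rfl⟩ := Finset.mem_map.1 he
      exact ⟨f.2, (Finset.mem_filter.1 hf).2⟩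
    refine hδ _ ?_ fun e he => ((hw e (hsub e he).1).resolve_left (hsub e he).2)
    exact hbo.comp (fun e : ((S.filter fun e : w => ¬ (e : E) ∈ V).map
      (Function.Embedding.subtype (· ∈ w))) => (⟨e, (hsub e e.2).1⟩ : w)) fun a b h =>
      Subtype.ext (congrArg (fun z : w => (z : E)) h)

end Resolvent

/-! ### Approximating exponentials by modulated monomials. -/

/-- Taylor remainder of the exponential when the degree dominates the modulus. -/
lemma norm_exp_sub_sum_le_two_mul_exp_neg {z : ℂ} {n : ℕ} (h : 9 * ‖z‖ ≤ n) :
    ‖Complex.exp z - ∑ k ∈ Finset.range n, z ^ k / k.factorial‖ ≤ 2 * Real.exp (-n) := by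
  have hn : (0 : ℝ) ≤ n := n.cast_nonneg
  have h0 : ‖z‖ / n.succ ≤ 1 / 2 := by
    rw [div_le_iff₀ (by positivity)]; push_cast; linarith [norm_nonneg z]
  refine (Complex.exp_bound' h0).trans ?_
  -- The constant 9 bounds `e²`: then `‖z‖ ≤ n e⁻²`, and `n ^ n / n! ≤ eⁿ` leaves `eⁿ e⁻²ⁿ = e⁻ⁿ`.
  have he : Real.exp 2 ≤ 9 := by
    have h2 : Real.exp 2 = Real.exp 1 ^ 2 := by rw [← Real.exp_nat_mul]; norm_num
    rw [h2]
    nlinarith [Real.exp_one_lt_d9, Real.exp_pos 1]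
  have hz : ‖z‖ ≤ n * Real.exp (-2) := by
    rw [Real.exp_neg, ← div_eq_mul_inv, le_div_iff₀ (Real.exp_pos _)]
    nlinarith [norm_nonneg z]
  calc ‖z‖ ^ n / n.factorial * 2 ≤ (n * Real.exp (-2)) ^ n / n.factorial * 2 := by gcongr
    _ = ((n : ℝ) ^ n / n.factorial) * Real.exp (-2) ^ n * 2 := by rw [mul_pow]; ring
    _ ≤ Real.exp n * Real.exp (-2) ^ n * 2 := by
        gcongr; exact Real.pow_div_factorial_le_exp _ hn n
    _ = 2 * Real.exp (-n) := by
        rw [← Real.exp_nat_mul, ← Real.exp_add, mul_comm]; congr 2; ring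

lemma ae_timeMeasure_mem (T : ℝ) : ∀ᵐ s ∂(timeMeasure T), s ∈ Set.Icc 0 T :=
  ae_cond_mem measurableSet_Icc

lemma Continuous.memLp_timeMeasure (T : ℝ) {g : ℝ → ℂ} (hg : Continuous g) :
    MemLp g 2 (timeMeasure T) := by
  obtain ⟨M, hM⟩ := (isCompact_Icc (a := (0 : ℝ)) (b := T)).exists_bound_of_continuousOn
    hg.continuousOn
  exact MemLp.of_bound hg.aestronglyMeasurable M ((ae_timeMeasure_mem T).mono hM)

lemma continuous_freqMonomial (c : ℝ) (k : ℕ) :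
    Continuous fun s : ℝ => Complex.exp (2 * Real.pi * Complex.I * c * s) * (s : ℂ) ^ k := by
  fun_prop

/-- The function `s ↦ exp (2πics) s ^ k` in `L₂(T)`. -/
noncomputable def freqMonomial (T c : ℝ) (k : ℕ) : TimeL2 T :=
  ((continuous_freqMonomial c k).memLp_timeMeasure T).toLp _

lemma coeFn_freqMonomial (T c : ℝ) (k : ℕ) : freqMonomial T c k =ᵐ[timeMeasure T]
    fun s : ℝ => Complex.exp (2 * Real.pi * Complex.I * c * s) * (s : ℂ) ^ k :=
  MemLp.coeFn_toLp _

/-- Makes orthogonality and Bessel's inequality available for Fourier coefficients; exponent 0 is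
the pure exponential. -/
lemma timeFourier_eq_inner (T : ℝ) (z : TimeL2 T) (ξ : ℝ) :
    timeFourier T z ξ = ⟪freqMonomial T ξ 0, z⟫_ℂ := by
  rw [L2.inner_def, timeFourier]
  refine integral_congr_ae ?_
  filter_upwards [coeFn_freqMonomial T ξ 0] with s hs
  rw [hs, RCLike.inner_apply, pow_zero, mul_one, ← Complex.exp_conj]
  simp only [map_mul, Complex.conj_I, Complex.conj_ofReal, map_ofNat]
  ring_nf

/-- Complex exponentials of frequency near `c` are almost combinations of few monomials
modulated at frequency `c`. -/
lemma exists_mem_span_freqMonomial_norm_sub_le {T c ξ : ℝ} (hT : 0 < T) {n : ℕ}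
    (h : 9 * (2 * Real.pi * |ξ - c| * T) ≤ n) :
    ∃ p ∈ Submodule.span ℂ (Set.range fun k : Fin n => freqMonomial T c k),
      ‖freqMonomial T ξ 0 - p‖ ≤ 2 * Real.exp (-n) := by
  refine ⟨∑ k : Fin n, ((2 * Real.pi * Complex.I * (ξ - c)) ^ (k : ℕ) / (k : ℕ).factorial) •
    freqMonomial T c k, Submodule.sum_mem _ fun k _ => Submodule.smul_mem _ _
      (Submodule.subset_span ⟨k, rfl⟩), ?_⟩
  -- For a probability measure a uniform bound is also an `L₂` bound, with no extra factor.
  have : IsProbabilityMeasure (timeMeasure T) :=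
    cond_isProbabilityMeasure_of_finite (by simp [hT]) (by simp)
  refine (Lp.norm_le_of_ae_bound (C := 2 * Real.exp (-n)) (by positivity) ?_).trans
    (by simp [measureUnivNNReal])
  have hsum : ⇑(∑ k : Fin n, ((2 * Real.pi * Complex.I * (ξ - c)) ^ (k : ℕ) /
      (k : ℕ).factorial) • freqMonomial T c k) =ᵐ[timeMeasure T] fun s => ∑ k : Fin n,
        ((2 * Real.pi * Complex.I * (ξ - c)) ^ (k : ℕ) / (k : ℕ).factorial) *
          freqMonomial T c k s := by
    refine (Lp.coeFn_finsetSum _ _).trans ?_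
    have hk : ∀ᵐ s ∂(timeMeasure T), ∀ k : Fin n,
        (((2 * Real.pi * Complex.I * (ξ - c)) ^ (k : ℕ) / (k : ℕ).factorial) •
          freqMonomial T c k : TimeL2 T) s =
        ((2 * Real.pi * Complex.I * (ξ - c)) ^ (k : ℕ) / (k : ℕ).factorial) *
          freqMonomial T c k s :=
      ae_all_iff.2 fun k => Lp.coeFn_smul _ _
    filter_upwards [hk] with s hs
    simp [hs]
  filter_upwards [ae_timeMeasure_mem T, hsum, coeFn_freqMonomial T ξ 0,
    ae_all_iff.2 fun k : Fin n => coeFn_freqMonomial T c k,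
    Lp.coeFn_sub (freqMonomial T ξ 0) (∑ k : Fin n, ((2 * Real.pi * Complex.I * (ξ - c)) ^
      (k : ℕ) / (k : ℕ).factorial) • freqMonomial T c k)] with s hs h1 h2 h3 h4
  rw [h4, Pi.sub_apply, h1, h2]
  simp only [h3]
  -- Factoring out the unimodular `exp (2πics)` leaves the Taylor remainder at `2πi(ξ - c)s`.
  have key : Complex.exp (2 * Real.pi * Complex.I * ξ * s) * (s : ℂ) ^ 0 -
      ∑ k : Fin n, ((2 * Real.pi * Complex.I * (ξ - c)) ^ (k : ℕ) / (k : ℕ).factorial) *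
        (Complex.exp (2 * Real.pi * Complex.I * c * s) * (s : ℂ) ^ (k : ℕ)) =
      Complex.exp (2 * Real.pi * Complex.I * c * s) *
        (Complex.exp (2 * Real.pi * Complex.I * (ξ - c) * s) -
          ∑ k ∈ Finset.range n, (2 * Real.pi * Complex.I * (ξ - c) * s) ^ k / k.factorial) := by
    rw [mul_sub (Complex.exp _), ← Complex.exp_add, Finset.mul_sum, ← Fin.sum_univ_eq_sum_range
      (fun k => Complex.exp (2 * Real.pi * Complex.I * c * s) *
        ((2 * Real.pi * Complex.I * (ξ - c) * s) ^ k / k.factorial))]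
    congr 1
    · rw [pow_zero, mul_one]; congr 1; ring
    · refine Finset.sum_congr rfl fun k _ => ?_
      rw [mul_pow _ (s : ℂ)]; ring
  rw [key, norm_mul, norm_exp_freq, one_mul]
  refine norm_exp_sub_sum_le_two_mul_exp_neg (le_trans ?_ h)
  have hn : ‖2 * Real.pi * Complex.I * (ξ - c) * (s : ℂ)‖ = 2 * Real.pi * |ξ - c| * |s| := by
    rw [← Complex.ofReal_sub]
    simp only [norm_mul, Complex.norm_I, Complex.norm_real, Complex.norm_ofNat, mul_one,
      Real.norm_eq_abs, abs_of_pos Real.pi_pos]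
  rw [hn, abs_of_nonneg hs.1]
  have := hs.2
  gcongr

/-! ### From approximation to the statistical dimension. -/

/-- If every exponential in the support of `μ` is within `δ` of `V`, then the operator has trace
at most `δ ^ 2` on `Vᗮ`. -/
lemma sum_re_inner_kernelOp_le {T : ℝ} {μ : Measure ℝ} [IsProbabilityMeasure μ]
    {V : Submodule ℂ (TimeL2 T)} {δ : ℝ}
    (hV : ∀ᵐ ξ ∂μ, ∃ p ∈ V, ‖freqMonomial T ξ 0 - p‖ ≤ δ) (S : Finset (TimeL2 T))
    (hS : Orthonormal ℂ (Subtype.val : S → TimeL2 T)) (hSV : ∀ e ∈ S, e ∈ Vᗮ) :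
    ∑ e ∈ S, (⟪e, kernelOp T μ e⟫_ℂ).re ≤ δ ^ 2 := by
  have hint : ∀ e ∈ S, Integrable (fun ξ => ‖timeFourier T e ξ‖ ^ 2) μ := fun e _ => by
    have hc := continuous_timeFourier T e
    refine Integrable.of_bound (C := ‖e‖ ^ 2)
      (by fun_prop : Continuous fun ξ => ‖timeFourier T e ξ‖ ^ 2).aestronglyMeasurable ?_
    refine Filter.Eventually.of_forall fun ξ => ?_
    rw [Real.norm_of_nonneg (by positivity)]
    gcongr
    exact norm_timeFourier_le T e ξ
  simp only [inner_kernelOp, Complex.ofReal_re]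
  rw [← integral_finsetSum S hint]
  have hle : ∀ᵐ ξ ∂μ, ∑ e ∈ S, ‖timeFourier T e ξ‖ ^ 2 ≤ δ ^ 2 := by
    filter_upwards [hV] with ξ ⟨p, hp, hpδ⟩
    -- Since `e ⊥ V`, subtracting `p` from the exponential changes no coefficient; Bessel then
    -- bounds the sum.
    calc ∑ e ∈ S, ‖timeFourier T e ξ‖ ^ 2
        = ∑ e ∈ S.attach, ‖⟪(e : TimeL2 T), freqMonomial T ξ 0 - p⟫_ℂ‖ ^ 2 := by
          rw [← Finset.sum_attach]
          refine Finset.sum_congr rfl fun e _ => ?_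
          rw [timeFourier_eq_inner, inner_sub_right,
            (Submodule.mem_orthogonal' V _).1 (hSV e e.2) p hp, sub_zero, norm_inner_symm]
      _ ≤ ‖freqMonomial T ξ 0 - p‖ ^ 2 := hS.sum_inner_products_le _
      _ ≤ δ ^ 2 := by gcongr
  refine (integral_mono_ae (integrable_finsetSum S hint) (integrable_const _) hle).trans ?_
  simp

lemma statDim_le_finrank_add {T : ℝ} {μ : Measure ℝ} [IsProbabilityMeasure μ]
    (V : Submodule ℂ (TimeL2 T)) [FiniteDimensional ℂ V] {δ ε : ℝ} (hε : 0 < ε)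
    (hV : ∀ᵐ ξ ∂μ, ∃ p ∈ V, ‖freqMonomial T ξ 0 - p‖ ≤ δ) :
    statDim T μ ε ≤ ENNReal.ofReal (Module.finrank ℂ V + δ ^ 2 / ε) := by
  have hu := isUnit_kernelOp_add T μ hε
  have hK := isPositive_kernelOp T μ
  refine opTrace_le_finrank_add (isPositive_kernelOp_mul_inverse T μ hε)
    (re_inner_mul_inverse_le_norm_sq hK hε hu) V fun S hS hSV => ?_
  rw [le_div_iff₀ hε, Finset.sum_mul]
  refine (Finset.sum_le_sum fun e _ => ?_).trans (sum_re_inner_kernelOp_le hV S hS hSV)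
  rw [mul_comm]
  exact mul_re_inner_mul_inverse_le hK hε hu e

/-! ### The multiband estimate. -/

lemma Set.OrdConnected.abs_sub_le_of_volume_eq {I : Set ℝ} (hI : I.OrdConnected) {F : ℝ}
    (hF : 0 ≤ F) (hv : volume I = ENNReal.ofReal F) {x y : ℝ} (hx : x ∈ I) (hy : y ∈ I) :
    |x - y| ≤ F := by
  have key : ∀ {a b}, a ∈ I → b ∈ I → b - a ≤ F := fun {a b} ha hb => by
    have := measure_mono (μ := volume) (hI.out ha hb)
    rw [hv, Real.volume_Icc] at this
    exact (ENNReal.ofReal_le_ofReal_iff hF).1 this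
  exact abs_sub_le_iff.2 ⟨key hy hx, key hx hy⟩

/-- The multiband bound with explicit constants. -/
lemma statDim_multiband_le {s : ℕ} (hs : 1 ≤ s) {I : Fin s → Set ℝ} {F : Fin s → ℝ}
    (hI : ∀ i, (I i).OrdConnected) (hF : ∀ i, 0 < F i)
    (hv : ∀ i, volume (I i) = ENNReal.ofReal (F i)) {T : ℝ} (hT : 0 < T) {ε : ℝ} (hε : 0 < ε)
    (hε1 : ε ≤ 1) :
    statDim T (volume[|⋃ i, I i]) ε ≤
      ENNReal.ofReal (18 * Real.pi * (∑ i, F i * T) + s * (5 + Real.log (1 / ε))) := by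
  have hlog : 0 ≤ Real.log (1 / ε) := Real.log_nonneg (by rwa [le_div_iff₀ hε, one_mul])
  have hne : ∀ i, (I i).Nonempty := fun i => by
    refine nonempty_of_measure_ne_zero (μ := volume) ?_
    rw [hv]; simpa using hF i
  choose c hc using hne
  have hmeas : MeasurableSet (⋃ i, I i) := MeasurableSet.iUnion fun i => (hI i).measurableSet
  have hpos : volume (⋃ i, I i) ≠ 0 := fun h => by
    have := measure_mono_null (Set.subset_iUnion I ⟨0, hs⟩) h
    rw [hv] at this
    simp only [ENNReal.ofReal_eq_zero] at this
    linarith [hF ⟨0, hs⟩]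
  have hfin : volume (⋃ i, I i) ≠ ∞ := by
    refine ((measure_iUnion_le I).trans_lt ?_).ne
    simp [tsum_fintype, hv]
  have hprob : IsProbabilityMeasure (volume[|⋃ i, I i]) :=
    cond_isProbabilityMeasure_of_finite hpos hfin
  -- `18π = 9 · 2π` meets the Taylor condition at distance up to `F i` from `c i`, so any point of
  -- the band may serve as `c i`. The logarithm makes `exp (-n i) ≤ ε`.
  let n : Fin s → ℕ := fun i => ⌈18 * Real.pi * (F i * T) + Real.log (1 / ε)⌉₊
  have hn : ∀ i, 18 * Real.pi * (F i * T) + Real.log (1 / ε) ≤ n i := fun i => Nat.le_ceil _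
  have hn' : ∀ i, (n i : ℝ) ≤ 18 * Real.pi * (F i * T) + Real.log (1 / ε) + 1 := fun i =>
    (Nat.ceil_lt_add_one (by have := hF i; positivity)).le
  let g : (Σ i, Fin (n i)) → TimeL2 T := fun p => freqMonomial T (c p.1) p.2
  have hV : ∀ᵐ ξ ∂(volume[|⋃ i, I i]), ∃ p ∈ Submodule.span ℂ (Set.range g),
      ‖freqMonomial T ξ 0 - p‖ ≤ 2 * ε := by
    filter_upwards [ae_cond_mem hmeas] with ξ hξ
    obtain ⟨i, hi⟩ := Set.mem_iUnion.1 hξ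
    have hd := (hI i).abs_sub_le_of_volume_eq (hF i).le (hv i) hi (hc i)
    have hb : 9 * (2 * Real.pi * |ξ - c i| * T) ≤ n i := by
      refine le_trans ?_ (hn i)
      calc 9 * (2 * Real.pi * |ξ - c i| * T) ≤ 9 * (2 * Real.pi * F i * T) := by gcongr
        _ ≤ 18 * Real.pi * (F i * T) + Real.log (1 / ε) := by linarith
    obtain ⟨p, hp, hpn⟩ := exists_mem_span_freqMonomial_norm_sub_le hT hb
    refine ⟨p, Submodule.span_mono ?_ hp, hpn.trans ?_⟩
    · rintro _ ⟨k, rfl⟩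
      exact ⟨⟨i, k⟩, rfl⟩
    · have : Real.exp (-(n i : ℝ)) ≤ ε := by
        rw [← Real.le_log_iff_exp_le hε]
        have h1 := hn i
        have h2 : 0 < 18 * Real.pi * (F i * T) := by have := hF i; positivity
        rw [one_div, Real.log_inv] at h1
        linarith
      gcongr
  have hfd : FiniteDimensional ℂ (Submodule.span ℂ (Set.range g)) :=
    FiniteDimensional.span_of_finite ℂ (Set.finite_range g)
  refine (statDim_le_finrank_add _ hε hV).trans (ENNReal.ofReal_le_ofReal ?_)
  have hr : (Module.finrank ℂ (Submodule.span ℂ (Set.range g)) : ℝ) ≤ ∑ i, (n i : ℝ) := by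
    have := finrank_range_le_card (R := ℂ) g
    rw [Fintype.card_sigma] at this
    simp only [Fintype.card_fin] at this
    exact_mod_cast this
  have hsum : ∑ i, (n i : ℝ) ≤
      18 * Real.pi * (∑ i, F i * T) + s * (Real.log (1 / ε) + 1) := by
    refine (Finset.sum_le_sum fun i _ => hn' i).trans (le_of_eq ?_)
    rw [Finset.mul_sum]
    simp only [add_assoc, Finset.sum_add_distrib, Finset.sum_const, Finset.card_univ,
      Fintype.card_fin, nsmul_eq_mul]
    ring
  -- This 4 and the 1 per band lost to the ceiling make up the 5 in the statement.
  have hd : (2 * ε) ^ 2 / ε ≤ 4 * s := by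
    have h1 : (1 : ℝ) ≤ s := by exact_mod_cast hs
    have h2 : (2 * ε) ^ 2 / ε = 4 * ε := by field_simp; ring
    rw [h2]; linarith
  linarith

theorem mainTheorem12 :
    (∃ C : ℝ, 0 < C ∧
      ∀ (s : ℕ), 1 ≤ s →
      ∀ (I : Fin s → Set ℝ) (F : Fin s → ℝ),
        (∀ i, (I i).OrdConnected) →
        (∀ i, 0 < F i) →
        (∀ i, volume (I i) = ENNReal.ofReal (F i)) →
        Pairwise (fun i j => Disjoint (I i) (I j)) →
      ∀ (T : ℝ), 0 < T →
      ∀ (ε : ℝ), 0 < ε → ε ≤ 1 →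
        statDim T (volume[|⋃ i, I i]) ε ≤
          ENNReal.ofReal (C * ((∑ i, F i * T) + s * (1 + Real.log (1 / ε))))) ∧
    (∀ ε₀ : ℝ, 0 < ε₀ → ε₀ < 1 → ∃ C : ℝ, 0 < C ∧
      ∀ (s : ℕ), 1 ≤ s →
      ∀ (I : Fin s → Set ℝ) (F : Fin s → ℝ),
        (∀ i, (I i).OrdConnected) →
        (∀ i, 0 < F i) →
        (∀ i, volume (I i) = ENNReal.ofReal (F i)) →
        Pairwise (fun i j => Disjoint (I i) (I j)) →
      ∀ (T : ℝ), 0 < T →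
      ∀ (ε : ℝ), 0 < ε → ε ≤ ε₀ →
        statDim T (volume[|⋃ i, I i]) ε ≤
          ENNReal.ofReal (C * ((∑ i, F i * T) + s * Real.log (1 / ε)))) := by
  have hpi : 0 < Real.pi := Real.pi_pos
  -- Covers both claims: `D = 1`, `L = 1 + log (1/ε)` for the first; `D = 1 + 1 / log (1/ε₀)`, `L =
  -- log (1/ε)` for the second.
  have hmain : ∀ (s : ℕ), 1 ≤ s → ∀ (I : Fin s → Set ℝ) (F : Fin s → ℝ),
      (∀ i, (I i).OrdConnected) → (∀ i, 0 < F i) →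
      (∀ i, volume (I i) = ENNReal.ofReal (F i)) →
      ∀ T : ℝ, 0 < T → ∀ ε : ℝ, 0 < ε → ε ≤ 1 → ∀ D : ℝ, 1 ≤ D → ∀ L : ℝ,
      1 + Real.log (1 / ε) ≤ D * L →
        statDim T (volume[|⋃ i, I i]) ε ≤
          ENNReal.ofReal ((18 * Real.pi + 5) * D * ((∑ i, F i * T) + s * L)) := by
    intro s hs I F hI hF hv T hT ε hε hε1 D hD L hL
    refine (statDim_multiband_le hs hI hF hv hT hε hε1).trans (ENNReal.ofReal_le_ofReal ?_)
    have hlog : 0 ≤ Real.log (1 / ε) := Real.log_nonneg (by rwa [le_div_iff₀ hε, one_mul])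
    have hS : 0 ≤ ∑ i, F i * T := Finset.sum_nonneg fun i _ => (mul_pos (hF i) hT).le
    have h1 : 18 * Real.pi * (∑ i, F i * T) ≤ (18 * Real.pi + 5) * D * ∑ i, F i * T := by
      refine mul_le_mul_of_nonneg_right ?_ hS
      nlinarith
    have h2 : (s : ℝ) * (5 + Real.log (1 / ε)) ≤ s * ((18 * Real.pi + 5) * (D * L)) := by
      refine mul_le_mul_of_nonneg_left ?_ s.cast_nonneg
      nlinarith
    linarith
  refine ⟨⟨18 * Real.pi + 5, by positivity, ?_⟩, fun ε₀ h0 h1 => ?_⟩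
  · intro s hs I F hI hF hv _ T hT ε hε hε1
    simpa using hmain s hs I F hI hF hv T hT ε hε hε1 1 le_rfl _ (one_mul _).ge
  · have hl0 : 0 < Real.log (1 / ε₀) := Real.log_pos (by rwa [lt_div_iff₀ h0, one_mul])
    refine ⟨(18 * Real.pi + 5) * (1 + 1 / Real.log (1 / ε₀)), by positivity, ?_⟩
    intro s hs I F hI hF hv _ T hT ε hε hεε
    refine hmain s hs I F hI hF hv T hT ε hε (hεε.trans h1.le) _
      (le_add_of_nonneg_right (by positivity)) _ ?_
    have hle : Real.log (1 / ε₀) ≤ Real.log (1 / ε) := by gcongr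
    have : 1 ≤ 1 / Real.log (1 / ε₀) * Real.log (1 / ε) := by
      rw [one_div_mul_eq_div, le_div_iff₀ hl0, one_mul]
      exact hle
    linarith
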